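/- Let $q$ be a prime power, let $t,n_1,\dots,n_t,m_1,\dots,m_t$ be positive integers with $m_1\ge\dots\ge m_t$ and $m_i\ge n_i$ for all $i$, and let $\mathbb M=\mathbb F_q^{m_1\times n_1}\times\dots\times\mathbb F_q^{m_t\times n_t}$. A code is an $\mathbb F_q$-linear subspace of $\mathbb M$. For $X=(X_1,\dots,X_t)\in\mathbb M$ let $\mathrm{srk}(X)=\sum_{i=1}^t\mathrm{rk}(X_i)$; for a code $\mathcal C$ let $\mathrm{maxsrk}(\mathcal C)=\max\{\mathrm{srk}(X):X\in\mathcal C\}$ and, if $\mathcal C\neq 0$, let $d(\mathcal C)=\min\{\mathrm{srk}(X):X\in\mathcal C\setminus\{0\}\}$. A linear subspace $\mathcal A_i\subseteq\mathbb F_q^{m_i\times n_i}$ is an optimal anticode if $\dim\mathcal A_i=m_i\max\{\mathrm{rk}(X):X\in\mathcal A_i\}$. Define $$\mathrm{wt}(\mathcal C)=\min\{\mathrm{maxsrk}(\mathcal A):\mathcal C\subseteq\mathcal A=\mathcal A_1\times\dots\times\mathcal A_t,\ \mathcal A_i\subseteq\mathbb F_q^{m_i\times n_i}\text{ an optimal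 anticode for all }i\},$$ and, for $1\le r\le\dim\mathcal C$, the $r$-th generalized sum-rank weight $$d_r(\mathcal C)=\min\{\mathrm{wt}(\mathcal C'):\mathcal C'\subseteq\mathcal C\text{ a linear subspace with }\dim\mathcal C'\ge r\}.$$ A code $\mathcal D\subseteq\mathbb M$ is MSRD (maximum sum-rank distance) if $\mathcal D\ne 0$ and there are $j\in\{1,\dots,t\}$ and $0\le\delta\le n_j-1$ with $d(\mathcal D)=\sum_{i=1}^{j-1}n_i+\delta+1$ and $\dim\mathcal D=\sum_{i=j}^t m_in_i-\delta m_j$. Proposition. Let $\mathcal C\subseteq\mathcal D\subseteq\mathbb M$ be codes and assume that $\mathcal D$ is MSRD. Then the sequence $d_1(\mathcal C),\dots,d_{\dim\mathcal C}(\mathcal C)$ of generalized weights of $\mathcal C$ is a subsequence of the sequence $d_1(\mathcal D),\dots,d_{\dim\mathcal D}(\mathcal D)$ of generalized weights of $\mathcal D$; that is, there are indices $1\le s_1<\dots<s_{\dim\mathcal C}\le\dim\mathcal D$ with $d_r(\mathcal C)=d_{s_r}(\mathcal D)$ for $1\le r\le\dim\mathcal C$. -/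

import Mathlib

namespace SumRank

/-- The ambient space `𝕄 = F^(m₁ × n₁) × ⋯ × F^(m_t × n_t)`. A (linear) sum-rank metric code is a
`Submodule F (Ambient F m n)`. -/
abbrev Ambient (F : Type*) {t : ℕ} (m n : Fin t → ℕ) : Type _ :=
  (i : Fin t) → Matrix (Fin (m i)) (Fin (n i)) F

/-- The sum-rank weight of a tuple of matrices. -/
noncomputable def srk {F : Type*} [Field F] {t : ℕ} {m n : Fin t → ℕ}
    (X : Ambient F m n) : ℕ :=
  ∑ i, (X i).rank

/-- The minimum distance of a nonzero code (the value for the zero code is irrelevant). -/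
noncomputable def minDist {F : Type*} [Field F] {t : ℕ} {m n : Fin t → ℕ}
    (C : Submodule F (Ambient F m n)) : ℕ :=
  sInf {d : ℕ | ∃ X ∈ C, X ≠ 0 ∧ srk X = d}

/-- The maximum sum-rank distance of a code: the maximum of the (nonempty, bounded) set of the
sum-rank weights of its elements. -/
noncomputable def maxsrk {F : Type*} [Field F] {t : ℕ} {m n : Fin t → ℕ}
    (C : Submodule F (Ambient F m n)) : ℕ :=
  sSup {d : ℕ | ∃ X ∈ C, srk X = d}

/-- The maximum rank of an element of a linear space of `a × b` matrices. -/
noncomputable def maxrk {F : Type*} [Field F] {a b : ℕ}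
    (A : Submodule F (Matrix (Fin a) (Fin b) F)) : ℕ :=
  sSup {d : ℕ | ∃ X ∈ A, X.rank = d}

/-- A linear space of `a × b` matrices (`b ≤ a`) is an optimal anticode if it attains the bound
`dim A ≤ a * maxrk A`. -/
def IsOptimalAnticode {F : Type*} [Field F] {a b : ℕ}
    (A : Submodule F (Matrix (Fin a) (Fin b) F)) : Prop :=
  Module.finrank F A = a * maxrk A

/-- The weight of a code: the least maximum sum-rank distance of a product `A₁ × ⋯ × A_t` of
optimal anticodes that contains the code. -/
noncomputable def wt {F : Type*} [Field F] {t : ℕ} {m n : Fin t → ℕ}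
    (C : Submodule F (Ambient F m n)) : ℕ :=
  sInf {w : ℕ | ∃ A : (i : Fin t) → Submodule F (Matrix (Fin (m i)) (Fin (n i)) F),
    (∀ i, IsOptimalAnticode (A i)) ∧ C ≤ Submodule.pi Set.univ A ∧
      maxsrk (Submodule.pi Set.univ A) = w}

/-- The `r`-th generalized sum-rank weight `d_r(C)`, meant for `1 ≤ r ≤ dim C`. -/
noncomputable def genWeight {F : Type*} [Field F] {t : ℕ} {m n : Fin t → ℕ}
    (C : Submodule F (Ambient F m n)) (r : ℕ) : ℕ :=
  sInf {w : ℕ | ∃ D : Submodule F (Ambient F m n), D ≤ C ∧ r ≤ Module.finrank F D ∧ wt D = w}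

/-- The sequence `d_1(C), …, d_k(C)` of generalized weights, `k = dim C`; the entry at the
zero-based index `r` is `d_{r+1}(C)`. -/
noncomputable def genWeightSeq {F : Type*} [Field F] {t : ℕ} {m n : Fin t → ℕ}
    (C : Submodule F (Ambient F m n)) : Fin (Module.finrank F C) → ℕ :=
  fun r => genWeight C (r + 1)

/-- Maximum sum-rank distance codes: for some block `j` and some `0 ≤ δ ≤ n_j - 1`,
`d(C) = ∑_{i<j} n_i + δ + 1` and `dim C = ∑_{i≥j} m_i n_i - δ m_j`. -/
def IsMSRD {F : Type*} [Field F] {t : ℕ} {m n : Fin t → ℕ}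
    (C : Submodule F (Ambient F m n)) : Prop :=
  ∃ (j : Fin t) (δ : ℕ), δ < n j ∧
    minDist C = ∑ i ∈ Finset.Iio j, n i + δ + 1 ∧
    Module.finrank F C + δ * m j = ∑ i ∈ Finset.Ici j, m i * n i

/-- A finite sequence `a` is a subsequence of a finite sequence `b`. -/
def IsSubsequence {k l : ℕ} (a : Fin k → ℕ) (b : Fin l → ℕ) : Prop :=
  ∃ f : Fin k → Fin l, StrictMono f ∧ ∀ r, a r = b (f r)

end SumRank

/-! Both sequences of generalized weights are nondecreasing, so it suffices that no value `w` occurs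
more often for `C` than for `D` (`isSubsequence_of_card_le`).

For every code, a positive value `w` occurs at most `blockHeight m n w` times
(`card_genWeightSeq_eq_le`). Indeed, enclose a code of weight `w` in a product of optimal anticodes
and shrink the last nonzero factor, in block `i`, to an optimal anticode of maximum rank one less:
this costs at most `m i` dimensions and lowers the weight (`exists_le_wt_lt`). For an MSRD code `D`,
all weights lie between `minDist D` and `∑ i, n i`, and the bounds `blockHeight m n w` over this
interval add up to at most `finrank F D` (`sum_blockHeight_add_le`); hence each bound is attained.
The weights of `C ≤ D` lie in the same interval.

The algebraic core is that an optimal anticode contains one of maximum rank one less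
(`exists_le_finrank_eq_of_rk_le`). Matrices are treated as bilinear forms, and a space of forms of
rank at most `k` and extremal dimension is studied through the elementary tensors `φ ⊗ ψ` that it
contains. -/

namespace SumRank

open Module LinearMap

/-! ### Dimension counts and greedy choice of independent vectors. -/

section LinearAlgebra

variable {K V W : Type*} [Field K] [AddCommGroup V] [Module K V] [AddCommGroup W] [Module K W]

lemma finrank_map_add_finrank_inf_ker [FiniteDimensional K V] (S : Submodule K V) (f : V →ₗ[K] W) :
    finrank K (S.map f) + finrank K (S ⊓ ker f : Submodule K V) = finrank K S := by
  rw [← finrank_range_add_finrank_ker (f.domRestrict S), range_domRestrict, ker_domRestrict]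
  congr 1
  rw [← (Submodule.equivSubtypeMap S (Submodule.comap S.subtype (ker f))).symm.finrank_eq,
    Submodule.map_comap_subtype]

/-- The map `f` embeds the quotient of `C` by the preimage of `A'` into `A / A'`. -/
lemma finrank_le_finrank_inf_comap [FiniteDimensional K V] [FiniteDimensional K W]
    {C : Submodule K V} {A A' : Submodule K W} (f : V →ₗ[K] W) (hC : C.map f ≤ A) (hA : A' ≤ A) :
    finrank K C + finrank K A' ≤ finrank K (C ⊓ A'.comap f : Submodule K V) + finrank K A := by
  have h1 := finrank_map_add_finrank_inf_ker C f
  have h2 := finrank_map_add_finrank_inf_ker (C ⊓ A'.comap f) f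
  have h3 : (C ⊓ A'.comap f).map f = C.map f ⊓ A' := by
    ext y
    simp only [Submodule.mem_map, Submodule.mem_inf, Submodule.mem_comap]
    constructor
    · rintro ⟨x, ⟨hx, hx'⟩, rfl⟩
      exact ⟨⟨x, hx, rfl⟩, hx'⟩
    · rintro ⟨⟨x, hx, rfl⟩, hx'⟩
      exact ⟨x, ⟨hx, hx'⟩, rfl⟩
  have h4 : (C ⊓ A'.comap f) ⊓ ker f = C ⊓ ker f := by
    refine le_antisymm (inf_le_inf_right _ inf_le_left) fun x hx => ⟨⟨hx.1, ?_⟩, hx.2⟩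
    simp [LinearMap.mem_ker.1 hx.2]
  have h5 := Submodule.finrank_sup_add_finrank_inf_eq (C.map f) A'
  have h6 := Submodule.finrank_mono (sup_le hC hA)
  rw [h3, h4] at h2
  omega

lemma exists_le_finrank_eq [FiniteDimensional K V] (L : Submodule K V) {k : ℕ}
    (hk : k ≤ finrank K L) : ∃ L' ≤ L, finrank K L' = k := by
  obtain ⟨v, hv⟩ := exists_linearIndependent_of_le_finrank hk
  have hv' : LinearIndependent K (fun i => (v i : V)) :=
    hv.map' L.subtype (Submodule.ker_subtype L)
  refine ⟨Submodule.span K (Set.range fun i => (v i : V)), ?_, ?_⟩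
  · rw [Submodule.span_le]
    rintro _ ⟨i, rfl⟩
    exact (v i).2
  · rw [finrank_span_eq_card hv', Fintype.card_fin]

/-- A linearly independent family can be extended by vectors from prescribed subspaces, as long as
the `j`-th subspace has dimension larger than `j`. -/
lemma exists_linearIndependent_extension (L : ℕ → Submodule K V) {s r : ℕ} (hsr : s ≤ r)
    (v : ℕ → V) (hv : LinearIndependent K fun i : Fin s => v i)
    (hL : ∀ j, s ≤ j → j < r → j < finrank K (L j)) :
    ∃ w : ℕ → V, (LinearIndependent K fun i : Fin r => w i) ∧ (∀ j < s, w j = v j) ∧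
      ∀ j, s ≤ j → j < r → w j ∈ L j := by
  induction r, hsr using Nat.le_induction with
  | base => exact ⟨v, hv, fun _ _ => rfl, fun j h1 h2 => absurd h1 (by omega)⟩
  | succ r hsr ih =>
    obtain ⟨w, hw, hwv, hwL⟩ := ih fun j h1 h2 => hL j h1 (by omega)
    have hspan : finrank K (Submodule.span K (Set.range fun i : Fin r => w i)) = r := by
      rw [finrank_span_eq_card hw, Fintype.card_fin]
    have hnot : ¬ L r ≤ Submodule.span K (Set.range fun i : Fin r => w i) := by
      intro h
      have : FiniteDimensional K (Submodule.span K (Set.range fun i : Fin r => w i)) :=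
        FiniteDimensional.span_of_finite K (Set.finite_range _)
      have := Submodule.finrank_mono h
      have := hL r hsr (by omega)
      omega
    obtain ⟨x, hxL, hx⟩ := SetLike.not_le_iff_exists.1 hnot
    refine ⟨Function.update w r x, ?_, fun j hj => ?_, fun j h1 h2 => ?_⟩
    · have : (fun i : Fin (r + 1) => Function.update w r x i)
          = Fin.snoc (α := fun _ => V) (fun i : Fin r => w i) x := by
        funext i
        refine Fin.lastCases ?_ (fun i => ?_) i
        · simp
        · simp [i.2.ne]
      rw [this, linearIndependent_finSnoc]
      exact ⟨hw, hx⟩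
    · rw [Function.update_of_ne (by omega), hwv j hj]
    · rcases eq_or_ne j r with rfl | hne
      · simpa using hxL
      · rw [Function.update_of_ne hne]
        exact hwL j h1 (by omega)

end LinearAlgebra

/-! ### Bilinear forms, their restrictions and their elementary tensors. -/

section Bilinear

universe u

set_option linter.unusedSectionVars false

variable {K E G : Type u} [Field K] [AddCommGroup E] [Module K E] [AddCommGroup G] [Module K G]
  [FiniteDimensional K E] [FiniteDimensional K G]

/-- The rank of a bilinear form on `E × G`. -/
noncomputable def rk (B : E →ₗ[K] Dual K G) : ℕ := finrank K (range B)

/-- The bilinear form `(x, y) ↦ φ x * ψ y`, as a linear function of `φ`. -/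
noncomputable def tens (ψ : Dual K G) : Dual K E →ₗ[K] (E →ₗ[K] Dual K G) :=
  LinearMap.smulRightₗ.flip ψ

/-- Restriction of bilinear forms to `E × q`. -/
noncomputable def resRight (q : Submodule K G) : (E →ₗ[K] Dual K G) →ₗ[K] (E →ₗ[K] Dual K q) :=
  LinearMap.compRight K q.dualRestrict

/-- Restriction of bilinear forms to `p × G`. -/
noncomputable def resLeft (p : Submodule K E) : (E →ₗ[K] Dual K G) →ₗ[K] (p →ₗ[K] Dual K G) :=
  LinearMap.lcomp K (Dual K G) p.subtype

/-- The space of all bilinear forms obtained from those in `S` by exchanging the arguments. -/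
noncomputable def flipSpace (S : Submodule K (E →ₗ[K] Dual K G)) :
    Submodule K (G →ₗ[K] Dual K E) :=
  S.map (LinearMap.lflip (R₀ := K)).toLinearMap

@[simp] lemma tens_apply (ψ : Dual K G) (φ : Dual K E) (x : E) (y : G) :
    tens ψ φ x y = φ x * ψ y := by
  simp [tens]

@[simp] lemma tens_apply' (ψ : Dual K G) (φ : Dual K E) (x : E) :
    tens ψ φ x = φ x • ψ := by
  ext; simp

@[simp] lemma resRight_apply (q : Submodule K G) (B : E →ₗ[K] Dual K G) (x : E) (y : q) :
    resRight q B x y = B x y := rfl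

lemma mem_flipSpace {S : Submodule K (E →ₗ[K] Dual K G)} {B : G →ₗ[K] Dual K E} :
    B ∈ flipSpace S ↔ B.flip ∈ S := by
  constructor
  · rintro ⟨C, hC, rfl⟩
    exact hC
  · intro h
    exact ⟨B.flip, h, rfl⟩

lemma tens_mem_flipSpace {S : Submodule K (E →ₗ[K] Dual K G)} {φ : Dual K E} {ψ : Dual K G} :
    tens φ ψ ∈ flipSpace S ↔ tens ψ φ ∈ S := by
  rw [mem_flipSpace]
  have : (tens φ ψ).flip = tens ψ φ := by
    ext x y
    simp [mul_comm]
  rw [this]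

lemma finrank_flipSpace (S : Submodule K (E →ₗ[K] Dual K G)) :
    finrank K (flipSpace S) = finrank K S :=
  LinearEquiv.finrank_map_eq (LinearMap.lflip (R₀ := K)) S

lemma rk_flip (B : E →ₗ[K] Dual K G) : rk B.flip = rk B := by
  have : B.flip = B.dualMap ∘ₗ (Module.evalEquiv K G).toLinearMap := by
    ext; simp
  rw [rk, this, LinearMap.range_comp, LinearEquiv.range, Submodule.map_top,
    LinearMap.finrank_range_dualMap_eq_finrank_range, rk]

lemma rk_flip_le {S : Submodule K (E →ₗ[K] Dual K G)} {k : ℕ} (hS : ∀ B ∈ S, rk B ≤ k) :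
    ∀ B ∈ flipSpace S, rk B ≤ k := by
  intro B hB
  rw [← rk_flip]
  exact hS _ (mem_flipSpace.1 hB)

lemma range_resRight (q : Submodule K G) (B : E →ₗ[K] Dual K G) :
    range (resRight q B) = (range B).map q.dualRestrict :=
  LinearMap.range_comp _ _

lemma range_resLeft (p : Submodule K E) (B : E →ₗ[K] Dual K G) :
    range (resLeft p B) = p.map B := by
  change range (B ∘ₗ p.subtype) = _
  rw [LinearMap.range_comp, Submodule.range_subtype]

lemma rk_resRight_le (q : Submodule K G) (B : E →ₗ[K] Dual K G) : rk (resRight q B) ≤ rk B := by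
  rw [rk, range_resRight]
  exact Submodule.finrank_map_le _ _

lemma exists_eq_one {φ : Dual K E} (hφ : φ ≠ 0) : ∃ e, φ e = 1 := by
  obtain ⟨x, hx⟩ := DFunLike.ne_iff.1 hφ
  exact ⟨(φ x)⁻¹ • x, by simpa using inv_mul_cancel₀ hx⟩

/-- If adding `φ ⊗ ψ` to `B` does not produce a form of rank larger than `k`, then restricting `B`
to the kernels of `φ` and `ψ` produces a form of rank smaller than `k`. -/
lemma rk_restrict_lt {B : E →ₗ[K] Dual K G} {φ : Dual K E} {ψ : Dual K G} {k : ℕ}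
    (hφ : φ ≠ 0) (hψ : ψ ≠ 0) (hB : rk B ≤ k) (hB' : rk (B + tens ψ φ) ≤ k) :
    rk (resLeft (ker φ) (resRight (ker ψ) B)) < k := by
  set P := (ker φ).map B with hP
  have hrange : range (resLeft (ker φ) (resRight (ker ψ) B)) = P.map (ker ψ).dualRestrict := by
    rw [range_resLeft, hP, ← Submodule.map_comp]
    rfl
  rw [rk, hrange]
  -- If the rank stayed at least `k`, then `P` would be the whole range of both `B` and `B + tens ψ
  -- φ`, and restriction to `ker ψ` would be injective on `P`. Evaluating both forms at `e` with `φ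
  -- e = 1` puts `ψ` into `P`, yet `ψ` restricts to zero.
  by_contra! hk
  have hcount := finrank_map_add_finrank_inf_ker P (ker ψ).dualRestrict
  have hP' : P = (ker φ).map (B + tens ψ φ) := by
    ext z
    simp only [hP, Submodule.mem_map, LinearMap.mem_ker]
    constructor
    · rintro ⟨x, hx, rfl⟩
      exact ⟨x, hx, by simp [hx]⟩
    · rintro ⟨x, hx, rfl⟩
      exact ⟨x, hx, by simp [hx]⟩
  have h1 : P = range B := by
    refine Submodule.eq_of_le_of_finrank_le LinearMap.map_le_range ?_
    rw [rk] at hB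
    omega
  have h2 : P = range (B + tens ψ φ) := by
    refine Submodule.eq_of_le_of_finrank_le (hP' ▸ LinearMap.map_le_range) ?_
    rw [rk] at hB'
    omega
  obtain ⟨e, he⟩ := exists_eq_one hφ
  have hmem : ψ ∈ P := by
    have h3 : B e ∈ P := h1 ▸ LinearMap.mem_range_self B e
    have h4 : B e + ψ ∈ P := by
      rw [h2]
      exact ⟨e, by simp [he]⟩
    simpa using P.sub_mem h4 h3
  have hpos : 0 < finrank K (P ⊓ ker (ker ψ).dualRestrict : Submodule K (Dual K G)) := by
    have hker : ψ ∈ ker (ker ψ).dualRestrict := by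
      rw [LinearMap.mem_ker]
      ext y
      exact LinearMap.mem_ker.1 y.2
    rw [Nat.pos_iff_ne_zero, Ne, Submodule.finrank_eq_zero]
    intro h
    exact hψ ((Submodule.mem_bot K).1 (h ▸ Submodule.mem_inf.2 ⟨hmem, hker⟩))
  rw [rk] at hB
  rw [← h1] at hB
  omega

/-- The functionals `φ` with `φ ⊗ ψ ∈ S`. -/
noncomputable def slice (S : Submodule K (E →ₗ[K] Dual K G)) (ψ : Dual K G) :
    Submodule K (Dual K E) :=
  S.comap (tens ψ)

@[simp] lemma mem_slice {S : Submodule K (E →ₗ[K] Dual K G)} {ψ : Dual K G} {φ : Dual K E} :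
    φ ∈ slice S ψ ↔ tens ψ φ ∈ S := Iff.rfl

lemma tens_injective {ψ : Dual K G} (hψ : ψ ≠ 0) :
    Function.Injective (tens ψ : Dual K E →ₗ[K] E →ₗ[K] Dual K G) := by
  obtain ⟨g, hg⟩ := exists_eq_one hψ
  intro φ φ' h
  ext x
  simpa [hg] using DFunLike.congr_fun (DFunLike.congr_fun h x) g

lemma ker_resRight (ψ : Dual K G) :
    ker (resRight (E := E) (ker ψ)) = range (tens (E := E) ψ) := by
  rcases eq_or_ne ψ 0 with rfl | hψ
  · ext B
    simp only [LinearMap.mem_ker, LinearMap.mem_range]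
    constructor
    · intro h
      refine ⟨0, ?_⟩
      ext x y
      simpa using (DFunLike.congr_fun (DFunLike.congr_fun h x) ⟨y, by simp⟩).symm
    · rintro ⟨φ, rfl⟩
      ext x y
      simp
  obtain ⟨g, hg⟩ := exists_eq_one hψ
  ext B
  simp only [LinearMap.mem_ker, LinearMap.mem_range]
  constructor
  · intro h
    refine ⟨B.flip g, ?_⟩
    ext x y
    have := DFunLike.congr_fun (DFunLike.congr_fun h x) ⟨y - ψ y • g, by simp [hg]⟩
    simp only [resRight_apply, map_sub, map_smul, smul_eq_mul, LinearMap.zero_apply] at this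
    simp only [tens_apply, flip_apply]
    linear_combination -this
  · rintro ⟨φ, rfl⟩
    ext x y
    have := LinearMap.mem_ker.1 y.2
    simp [this]

lemma finrank_eq_resRight_add_slice (S : Submodule K (E →ₗ[K] Dual K G)) {ψ : Dual K G}
    (hψ : ψ ≠ 0) :
    finrank K S = finrank K (S.map (resRight (ker ψ))) + finrank K (slice S ψ) := by
  have h := finrank_map_add_finrank_inf_ker (V := E →ₗ[K] Dual K G)
    (W := E →ₗ[K] Dual K (ker ψ)) S (resRight (ker ψ))
  rw [ker_resRight, inf_comm, ← Submodule.map_comap_eq] at h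
  rw [← h]
  exact congrArg _ (Submodule.equivMapOfInjective _ (tens_injective hψ) (slice S ψ)).finrank_eq.symm

lemma finrank_le_resLeft_add (S : Submodule K (E →ₗ[K] Dual K G)) {φ : Dual K E} (hφ : φ ≠ 0) :
    finrank K S ≤ finrank K (S.map (resLeft (ker φ))) + finrank K G := by
  have h := finrank_eq_resRight_add_slice (flipSpace S) hφ
  have h1 : finrank K (slice (flipSpace S) φ) ≤ finrank K G :=
    (Submodule.finrank_le _).trans Subspace.dual_finrank_eq.le
  have h2 : (flipSpace S).map (resRight (ker φ)) = flipSpace (S.map (resLeft (ker φ))) := by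
    ext B
    rw [mem_flipSpace]
    constructor
    · rintro ⟨C, hC, rfl⟩
      exact ⟨C.flip, mem_flipSpace.1 hC, rfl⟩
    · rintro ⟨C, hC, h⟩
      refine ⟨C.flip, mem_flipSpace.2 hC, ?_⟩
      rw [← B.flip_flip, ← h]
      rfl
  rw [h2, finrank_flipSpace, finrank_flipSpace] at h
  omega

/-! ### Sums of elementary tensors and Flanders' bound. -/

lemma le_rk_sum_tens {r : ℕ} {φ : Fin r → Dual K E} {ψ : Fin r → Dual K G}
    (hφ : LinearIndependent K φ) (hψ : LinearIndependent K ψ) :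
    r ≤ rk (∑ i, tens (ψ i) (φ i)) := by
  have h1 : ker (∑ i, tens (ψ i) (φ i)) ≤
      (Submodule.span K (Set.range φ)).dualCoannihilator := by
    intro x hx
    have hx' : ∑ i, φ i x • ψ i = 0 := by
      simpa [LinearMap.sum_apply] using LinearMap.mem_ker.1 hx
    have h0 := Fintype.linearIndependent_iff.1 hψ _ hx'
    rw [Submodule.mem_dualCoannihilator]
    intro η hη
    induction hη using Submodule.span_induction with
    | mem η hη => obtain ⟨i, rfl⟩ := hη; exact h0 i
    | zero => simp
    | add a b _ _ ha hb => simp [ha, hb]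
    | smul c a _ ha => simp [ha]
  have h2 := Submodule.finrank_mono h1
  have h3 := Subspace.finrank_add_finrank_dualCoannihilator_eq (Submodule.span K (Set.range φ))
  rw [finrank_span_eq_card hφ, Fintype.card_fin] at h3
  have h4 := LinearMap.finrank_range_add_finrank_ker (∑ i, tens (ψ i) (φ i))
  rw [rk]
  omega

/-- A space of bilinear forms of rank at most `k` cannot contain `φ i ⊗ ψ i` for two linearly
independent families of length larger than `k`. -/
lemma le_of_tens_mem {S : Submodule K (E →ₗ[K] Dual K G)} {k r : ℕ} (hS : ∀ B ∈ S, rk B ≤ k)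
    {φ : Fin r → Dual K E} {ψ : Fin r → Dual K G}
    (hφ : LinearIndependent K φ) (hψ : LinearIndependent K ψ)
    (hmem : ∀ i, φ i ∈ slice S (ψ i)) : r ≤ k :=
  (le_rk_sum_tens hφ hψ).trans (hS _ (S.sum_mem fun i _ => hmem i))

/-- Otherwise, for `k + 1` independent `ψ j`, independent `φ j` can be picked greedily from the
slices, and the sum of the tensors has rank larger than `k`. -/
lemma exists_finrank_slice_le {S : Submodule K (E →ₗ[K] Dual K G)} {k : ℕ}
    (hS : ∀ B ∈ S, rk B ≤ k) (hk : k < finrank K G) :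
    ∃ ψ : Dual K G, ψ ≠ 0 ∧ finrank K (slice S ψ) ≤ k := by
  by_contra! h
  obtain ⟨ψ, hψ, -, -⟩ := exists_linearIndependent_extension (K := K)
    (fun _ => (⊤ : Submodule K (Dual K G))) (Nat.zero_le (k + 1)) (fun _ => 0)
    linearIndependent_empty_type fun j _ hj => by
      rw [finrank_top, Subspace.dual_finrank_eq]; omega
  obtain ⟨φ, hφ, -, hφS⟩ := exists_linearIndependent_extension (K := K)
    (fun j => slice S (ψ j)) (Nat.zero_le (k + 1)) (fun _ => 0)
    linearIndependent_empty_type fun j _ hj =>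
      lt_of_le_of_lt (Nat.lt_succ_iff.1 hj) (h _ (hψ.ne_zero ⟨j, hj⟩))
  have := le_of_tens_mem hS hφ hψ fun i => hφS i (Nat.zero_le _) i.2
  omega

lemma finrank_ker_add_one {φ : Dual K E} (hφ : φ ≠ 0) : finrank K (ker φ) + 1 = finrank K E := by
  have h := LinearMap.finrank_range_add_finrank_ker φ
  rw [LinearMap.range_eq_top.2 (LinearMap.surjective hφ), finrank_top, finrank_self] at h
  omega

lemma rk_le_of_mem_map_resRight {S : Submodule K (E →ₗ[K] Dual K G)} {k : ℕ}
    (hS : ∀ B ∈ S, rk B ≤ k) (q : Submodule K G) : ∀ B ∈ S.map (resRight q), rk B ≤ k := by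
  rintro _ ⟨B, hB, rfl⟩
  exact (rk_resRight_le q B).trans (hS B hB)

lemma rk_lt_of_mem_map_restrict {S : Submodule K (E →ₗ[K] Dual K G)} {k : ℕ}
    (hS : ∀ B ∈ S, rk B ≤ k) {φ : Dual K E} {ψ : Dual K G} (hφ : φ ≠ 0) (hψ : ψ ≠ 0)
    (hmem : φ ∈ slice S ψ) :
    ∀ B ∈ (S.map (resRight (ker ψ))).map (resLeft (ker φ)), rk B ≤ k - 1 := by
  rintro _ ⟨_, ⟨B, hB, rfl⟩, rfl⟩
  have := rk_restrict_lt hφ hψ (hS B hB) (hS _ (S.add_mem hB hmem))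
  omega

/-- Restricting to `ker ψ` loses exactly the slice; restricting further to `ker φ` loses at most
`finrank K (ker ψ)`, which is `finrank K G - 1`. -/
lemma finrank_le_of_mem_slice (S : Submodule K (E →ₗ[K] Dual K G))
    {φ : Dual K E} {ψ : Dual K G} (hφ : φ ≠ 0) (hψ : ψ ≠ 0) :
    finrank K S + 1 ≤ finrank K ((S.map (resRight (ker ψ))).map (resLeft (ker φ)))
      + finrank K G + finrank K (slice S ψ) := by
  have h1 := finrank_eq_resRight_add_slice S hψ
  have h2 := finrank_le_resLeft_add (S.map (resRight (ker ψ))) hφ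
  have h3 := finrank_ker_add_one hψ
  omega

lemma finrank_le_of_rk_le_aux (N : ℕ) : ∀ (E G : Type u) [AddCommGroup E] [Module K E]
    [AddCommGroup G] [Module K G] [FiniteDimensional K E] [FiniteDimensional K G]
    (S : Submodule K (E →ₗ[K] Dual K G)) (k : ℕ), finrank K E + finrank K G ≤ N →
    (∀ B ∈ S, rk B ≤ k) → finrank K S ≤ max (finrank K E) (finrank K G) * k := by
  induction N with
  | zero =>
    intro E G _ _ _ _ _ _ S k hN hS
    have h := Submodule.finrank_le S
    rw [Module.finrank_linearMap, Subspace.dual_finrank_eq] at h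
    have h0 : finrank K E = 0 := by omega
    rw [h0, zero_mul] at h
    omega
  | succ N ih =>
    have main : ∀ (E G : Type u) [AddCommGroup E] [Module K E]
        [AddCommGroup G] [Module K G] [FiniteDimensional K E] [FiniteDimensional K G]
        (S : Submodule K (E →ₗ[K] Dual K G)) (k : ℕ), finrank K E ≤ finrank K G →
        finrank K E + finrank K G ≤ N + 1 →
        (∀ B ∈ S, rk B ≤ k) → finrank K S ≤ finrank K G * k := by
      intro E G _ _ _ _ _ _ S k hEG hN hS
      rcases le_or_gt (finrank K E) k with hk | hk
      · have h := Submodule.finrank_le S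
        rw [Module.finrank_linearMap, Subspace.dual_finrank_eq, mul_comm] at h
        exact h.trans (Nat.mul_le_mul_left _ hk)
      obtain ⟨ψ, hψ, hψk⟩ := exists_finrank_slice_le hS (hk.trans_le hEG)
      have hG := finrank_ker_add_one hψ
      -- An empty slice makes restriction to `ker ψ` injective. Otherwise both arguments are
      -- restricted, the rank bound drops to `k - 1`, and with `g = finrank K G` the count is `(g -
      -- 1)(k - 1) + (g - 1) + k = g * k`.
      rcases eq_or_ne (slice S ψ) ⊥ with h0 | h0
      · have h1 := finrank_eq_resRight_add_slice S hψ
        have h2 := ih E (ker ψ) (S.map (resRight (ker ψ))) k (by omega)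
          (rk_le_of_mem_map_resRight hS _)
        rw [h0, finrank_bot, add_zero] at h1
        rw [h1]
        exact h2.trans (Nat.mul_le_mul_right _ (max_le hEG (by omega)))
      · obtain ⟨φ, hφS, hφ⟩ := Submodule.exists_mem_ne_zero_of_ne_bot h0
        have hE := finrank_ker_add_one hφ
        have h1 := finrank_le_of_mem_slice S hφ hψ
        have h2 := ih (ker φ) (ker ψ) ((S.map (resRight (ker ψ))).map (resLeft (ker φ))) (k - 1)
          (by omega) (rk_lt_of_mem_map_restrict hS hφ hψ hφS)
        rw [max_eq_right (by omega)] at h2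
        have hk0 : 0 < finrank K (slice S ψ) := Nat.pos_of_ne_zero fun h =>
          h0 (Submodule.finrank_eq_zero.1 h)
        obtain ⟨j, rfl⟩ : ∃ j, k = j + 1 := ⟨k - 1, by omega⟩
        rw [Nat.add_sub_cancel] at h2
        rw [← hG] at h1 ⊢
        nlinarith
    intro E G _ _ _ _ _ _ S k hN hS
    rcases le_total (finrank K E) (finrank K G) with h | h
    · rw [max_eq_right h]
      exact main E G S k h hN hS
    · rw [max_eq_left h, ← finrank_flipSpace]
      exact main G E (flipSpace S) k h (by omega) (rk_flip_le hS)

/-- **Flanders' theorem**: the dimension of a space of bilinear forms of rank at most `k`. -/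
theorem finrank_le_of_rk_le {S : Submodule K (E →ₗ[K] Dual K G)} {k : ℕ}
    (hS : ∀ B ∈ S, rk B ≤ k) : finrank K S ≤ max (finrank K E) (finrank K G) * k :=
  finrank_le_of_rk_le_aux _ E G S k le_rfl hS

/-! ### Spaces of bounded rank that attain Flanders' bound. -/

lemma le_finrank_slice {S : Submodule K (E →ₗ[K] Dual K G)} {k : ℕ}
    (hS : ∀ B ∈ S, rk B ≤ k) (hEG : finrank K E ≤ finrank K G)
    (hdim : finrank K S = finrank K G * k) {ψ : Dual K G} (hψ : ψ ≠ 0) (h0 : slice S ψ ≠ ⊥) :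
    k ≤ finrank K (slice S ψ) := by
  obtain ⟨φ, hφS, hφ⟩ := Submodule.exists_mem_ne_zero_of_ne_bot h0
  have hE := finrank_ker_add_one hφ
  have hG := finrank_ker_add_one hψ
  have h1 := finrank_le_of_mem_slice S hφ hψ
  -- Flanders' bound for the doubly restricted space leaves at least `g * k - (g - 1)(k - 1) - (g -
  -- 1) = k` dimensions for the slice, where `g = finrank K G`.
  have h2 := finrank_le_of_rk_le (rk_lt_of_mem_map_restrict hS hφ hψ hφS)
  rw [max_eq_right (by omega)] at h2
  rcases k with _ | j
  · omega
  rw [Nat.add_sub_cancel] at h2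
  rw [← hG] at h1 hdim
  nlinarith

/-- A vector `η` violating the inclusion would yield `k + 1` elementary tensors in `S` with
independent factors on both sides, so a form of rank larger than `k`. -/
lemma slice_le_slice {S : Submodule K (E →ₗ[K] Dual K G)} {k : ℕ}
    (hS : ∀ B ∈ S, rk B ≤ k) (hk0 : 0 < k) (hk : k < finrank K G)
    (hslice : ∀ ψ : Dual K G, ψ ≠ 0 → k ≤ finrank K (slice S ψ))
    {ψ₁ ψ₂ : Dual K G} (hψ₁ : ψ₁ ≠ 0) (hψ₂ : ψ₂ ≠ 0) : slice S ψ₂ ≤ slice S ψ₁ := by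
  intro η hη
  by_contra hη₁
  have hpair : LinearIndependent K fun i : Fin 2 => if (i : ℕ) = 0 then ψ₁ else ψ₂ := by
    have : LinearIndependent K ![ψ₁, ψ₂] := by
      rw [LinearIndependent.pair_iff' hψ₁]
      rintro a rfl
      have ha : a ≠ 0 := by
        rintro rfl
        simp at hψ₂
      have h : tens (a • ψ₁) η = a • tens ψ₁ η := by
        ext; simp; ring
      rw [mem_slice, h] at hη
      exact hη₁ ((S.smul_mem_iff ha).1 hη)
    convert this using 1
    funext i
    fin_cases i <;> rfl
  obtain ⟨ψ, hψ, hψv, -⟩ := exists_linearIndependent_extension (K := K)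
    (fun _ => (⊤ : Submodule K (Dual K G))) (show 2 ≤ k + 1 by omega)
    (fun i => if i = 0 then ψ₁ else ψ₂) hpair fun j _ hj => by
      rw [finrank_top, Subspace.dual_finrank_eq]; omega
  have hψ0 : ψ 0 = ψ₁ := hψv 0 (by omega)
  have hψ1 : ψ 1 = ψ₂ := hψv 1 (by omega)
  have hη0 : η ≠ 0 := by
    rintro rfl
    exact hη₁ (Submodule.zero_mem _)
  obtain ⟨φ, hφ, hφv, hφS⟩ := exists_linearIndependent_extension (K := K)
    (fun j => slice S (ψ (j + 1))) (show 1 ≤ k by omega) (fun _ => η)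
    (linearIndependent_unique_iff.2 hη0) fun j _ hj =>
      hj.trans_le (hslice _ (hψ.ne_zero (⟨j + 1, by omega⟩ : Fin (k + 1))))
  have hφ0 : φ 0 = η := hφv 0 (by omega)
  have hspan : finrank K (Submodule.span K (Set.range fun i : Fin k => φ i)) = k := by
    rw [finrank_span_eq_card hφ, Fintype.card_fin]
  -- The slice of `ψ₁` was held back for the end: it has dimension at least `k`, so lying in this
  -- `k`-dimensional span would make it equal to the span, which contains `η`.
  have hnot : ¬ slice S ψ₁ ≤ Submodule.span K (Set.range fun i : Fin k => φ i) := by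
    intro h
    have heq := Submodule.eq_of_le_of_finrank_le h (by rw [hspan]; exact hslice _ hψ₁)
    rw [heq] at hη₁
    exact hη₁ (Submodule.subset_span ⟨⟨0, hk0⟩, hφ0⟩)
  obtain ⟨x, hx, hxspan⟩ := SetLike.not_le_iff_exists.1 hnot
  have := le_of_tens_mem hS (hφ.finCons hxspan) hψ fun i => by
    refine Fin.cases ?_ (fun i => ?_) i
    · simpa [hψ0] using hx
    · rw [Fin.cons_succ]
      rcases Nat.eq_zero_or_pos (i : ℕ) with hi | hi
      · rw [Fin.val_succ, hi, hφ0, hψ1]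
        exact hη
      · exact hφS i hi i.2
  omega

/-- A space of forms of rank at most `k` and of maximal dimension that contains an elementary
tensor with any given second factor contains all tensors with first factor in a space of dimension
at least `k`. -/
lemma exists_common_slice {S : Submodule K (E →ₗ[K] Dual K G)} {k : ℕ}
    (hS : ∀ B ∈ S, rk B ≤ k) (hEG : finrank K E ≤ finrank K G) (hk0 : 0 < k)
    (hkE : k ≤ finrank K E) (hdim : finrank K S = finrank K G * k)
    (hslice : ∀ ψ : Dual K G, ψ ≠ 0 → slice S ψ ≠ ⊥) :
    ∃ L : Submodule K (Dual K E), k ≤ finrank K L ∧ ∀ φ ∈ L, ∀ ψ, tens ψ φ ∈ S := by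
  rcases (hkE.trans hEG).eq_or_lt with hk | hk
  · refine ⟨⊤, ?_, fun φ _ ψ => ?_⟩
    · rw [finrank_top, Subspace.dual_finrank_eq]
      exact hkE
    · have : S = ⊤ := by
        refine Submodule.eq_top_of_finrank_eq (V := E →ₗ[K] Dual K G) ?_
        rw [hdim, Module.finrank_linearMap, Subspace.dual_finrank_eq, mul_comm]
        congr 1
        omega
      rw [this]
      trivial
  · have hle := fun ψ hψ => le_finrank_slice hS hEG hdim hψ (hslice ψ hψ)
    have : Nontrivial (Dual K G) := by
      apply Module.nontrivial_of_finrank_pos (R := K)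
      rw [Subspace.dual_finrank_eq]
      omega
    obtain ⟨ψ₂, hψ₂⟩ := exists_ne (0 : Dual K G)
    refine ⟨slice S ψ₂, hle _ hψ₂, fun φ hφ ψ => ?_⟩
    rcases eq_or_ne ψ 0 with rfl | hψ
    · convert S.zero_mem
      ext; simp
    · exact slice_le_slice hS hk0 hk hle hψ hψ₂ hφ

/-- With a zero slice, `S` embeds into forms on `E × ker ψ`. Since `E` is strictly smaller than `G`,
the larger side is now `ker ψ`, and Flanders' bound is too small. -/
lemma slice_ne_bot_of_lt {S : Submodule K (E →ₗ[K] Dual K G)} {k : ℕ}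
    (hS : ∀ B ∈ S, rk B ≤ k) (hEG : finrank K E < finrank K G) (hk0 : 0 < k)
    (hdim : finrank K S = finrank K G * k) {ψ : Dual K G} (hψ : ψ ≠ 0) : slice S ψ ≠ ⊥ := by
  intro h0
  have h1 := finrank_eq_resRight_add_slice S hψ
  have h2 := finrank_le_of_rk_le (rk_le_of_mem_map_resRight hS (ker ψ))
  have hG := finrank_ker_add_one hψ
  rw [h0, finrank_bot, add_zero] at h1
  rw [max_eq_right (by omega), ← h1, hdim, ← hG] at h2
  nlinarith

/-- As the rank does not drop, restriction to `q` is injective on the range of `Y`. -/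
lemma apply_eq_zero_of_rk_resRight {Y : E →ₗ[K] Dual K G} {q : Submodule K G} {k : ℕ}
    (hY : rk Y ≤ k) (hY' : k ≤ rk (resRight q Y)) {x : E} (hx : resRight q Y x = 0) : Y x = 0 := by
  have h := finrank_map_add_finrank_inf_ker (range Y) q.dualRestrict
  rw [rk, range_resRight] at hY'
  rw [rk] at hY
  have h0 : range Y ⊓ ker q.dualRestrict = ⊥ := by
    rw [← Submodule.finrank_eq_zero (R := K)]
    omega
  have : Y x ∈ range Y ⊓ ker q.dualRestrict := ⟨LinearMap.mem_range_self Y x, hx⟩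
  rwa [h0, Submodule.mem_bot] at this

/-- In the square case, a space of forms of rank at most `k` and of maximal dimension contains
an elementary tensor for any given second factor or for any given first factor. -/
lemma slice_flipSpace_ne_bot {S : Submodule K (E →ₗ[K] Dual K G)} {k : ℕ}
    (hS : ∀ B ∈ S, rk B ≤ k) (hEG : finrank K E = finrank K G) (hk0 : 0 < k)
    (hk : k < finrank K E) (hdim : finrank K S = finrank K G * k) {ψ₀ : Dual K G} (hψ₀ : ψ₀ ≠ 0)
    (h0 : slice S ψ₀ = ⊥) {φ : Dual K E} (hφ : φ ≠ 0) : slice (flipSpace S) φ ≠ ⊥ := by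
  have hG := finrank_ker_add_one hψ₀
  set T := S.map (resRight (ker ψ₀))
  have hTS : finrank K (flipSpace T) = finrank K E * k := by
    have h1 := finrank_eq_resRight_add_slice S hψ₀
    rw [h0, finrank_bot, add_zero, hdim, ← hEG] at h1
    rw [finrank_flipSpace, h1]
  have hTk := rk_flip_le (rk_le_of_mem_map_resRight hS (ker ψ₀))
  -- Restriction to `ker ψ₀` is injective on `S` and makes the two sides unequal, so the non-square
  -- case applies to the flipped restricted space.
  obtain ⟨Z, hZk, hZ⟩ := exists_common_slice hTk (by omega) hk0 (by omega) hTS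
    fun φ hφ => slice_ne_bot_of_lt hTk (by omega) hk0 hTS hφ
  have hZ' : ∀ ζ ∈ Z, ∀ φ, tens ζ φ ∈ T := fun ζ hζ φ => tens_mem_flipSpace.1 (hZ ζ hζ φ)
  obtain ⟨ζ, hζ, -, hζZ⟩ := exists_linearIndependent_extension (K := K)
    (fun _ => Z) (Nat.zero_le k) (fun _ => 0) linearIndependent_empty_type fun j _ hj =>
      hj.trans_le hZk
  have hζZ' : ∀ i : Fin k, ζ i ∈ Z := fun i => hζZ i (Nat.zero_le _) i.2
  have hlift : ∀ s : Fin k → Dual K E, LinearIndependent K s → ∀ Y ∈ S,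
      resRight (ker ψ₀) Y = ∑ i : Fin k, tens (ζ i) (s i) → ∀ x, (∀ i, s i x = 0) → Y x = 0 := by
    intro s hs Y hY hYs x hx
    refine apply_eq_zero_of_rk_resRight (hS Y hY) (hYs ▸ le_rk_sum_tens hs hζ) ?_
    rw [hYs]
    simp [LinearMap.sum_apply, hx]
  let i₀ : Fin k := ⟨k - 1, by omega⟩
  obtain ⟨X, hXS, hX⟩ := hZ' (ζ i₀) (hζZ' i₀) φ
  -- The form `X` lifts a tensor with first factor `φ`; vanishing on `ker φ` will make `X` itself
  -- such a tensor. Given `x` in `ker φ`, complete `φ` to `k` independent functionals killing `x`. A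
  -- lift `Y` of the resulting rank `k` sum kills `x`. So does `X + Y`, whose restriction only
  -- changes the last functional by adding `φ`; subtract.
  have hker : ∀ x, φ x = 0 → X x = 0 := by
    intro x hx
    rcases eq_or_ne x 0 with rfl | hx0
    · simp
    have hA : finrank K (Submodule.dualAnnihilator (K ∙ x)) + 1 = finrank K E := by
      rw [← Subspace.finrank_add_finrank_dualAnnihilator_eq (K ∙ x), finrank_span_singleton hx0,
        add_comm]
    obtain ⟨s, hs, hsφ, hsA⟩ := exists_linearIndependent_extension (K := K)
      (fun _ => Submodule.dualAnnihilator (K ∙ x)) (show 1 ≤ k by omega) (fun _ => φ)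
      (linearIndependent_unique_iff.2 hφ) fun j _ hj => by omega
    have hs0 : s 0 = φ := hsφ 0 (by omega)
    have hsx : ∀ i : Fin k, s i x = 0 := by
      intro i
      rcases Nat.eq_zero_or_pos (i : ℕ) with hi | hi
      · rw [hi, hs0, hx]
      · exact (Submodule.mem_dualAnnihilator _).1 (hsA i hi i.2) x
          (Submodule.mem_span_singleton_self x)
    rcases (show k = 1 ∨ 1 < k by omega) with rfl | hk1
    · refine hlift _ hs X hXS ?_ x hsx
      rw [hX, Fin.sum_univ_one]
      simp [i₀, hs0]
    · obtain ⟨Y, hYS, hY⟩ : ∑ i : Fin k, tens (ζ i) (s i) ∈ T :=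
        T.sum_mem fun i _ => hZ' _ (hζZ' i) _
      have hYx := hlift _ hs Y hYS hY x hsx
      have hc : (Pi.single i₀ 1 : Fin k → K) ⟨0, hk0⟩ = 0 := by
        rw [Pi.single_eq_of_ne]
        intro h
        have := congrArg Fin.val h
        simp only [i₀] at this
        omega
      have hs' := (linearIndependent_add_smul_iff (v := fun i : Fin k => s i) hc).2 hs
      have hXYx := hlift _ hs' (X + Y) (S.add_mem hXS hYS) (by
        rw [map_add, hX, hY]
        simp only [Pi.add_apply, map_add, map_smul, Finset.sum_add_distrib, hs0]
        rw [add_comm]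
        refine congrArg₂ _ rfl ?_
        rw [Finset.sum_eq_single i₀]
        · simp
        · intro i _ hi
          simp [Pi.single_eq_of_ne hi]
        · simp) x (by
        intro i
        simp [hsx, hs0, hx])
      simpa [hYx] using hXYx
  obtain ⟨e, he⟩ := exists_eq_one hφ
  have hXe : X = tens (X e) φ := by
    ext x y
    have h := DFunLike.congr_fun (hker (x - φ x • e) (by simp [he])) y
    simp only [map_sub, map_smul, LinearMap.sub_apply, LinearMap.smul_apply, smul_eq_mul,
      LinearMap.zero_apply] at h
    simp only [tens_apply]
    linear_combination h
  have hX0 : X e ≠ 0 := by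
    intro h
    rw [h] at hXe
    have h1 : tens (ζ i₀) φ = 0 := by
      rw [← hX, hXe]
      ext; simp
    exact hφ (tens_injective (hζ.ne_zero i₀) (h1.trans (map_zero _).symm))
  intro hbot
  refine hX0 ((Submodule.mem_bot K).1 (hbot ▸ ?_))
  rw [mem_slice, tens_mem_flipSpace, ← hXe]
  exact hXS

/-- The space of forms obtained from functionals in `L` contains, for each dimension `j` of a
subspace of `L`, a space of forms of rank at most `j`. -/
lemma exists_le_of_common_slice {S : Submodule K (E →ₗ[K] Dual K G)}
    {L : Submodule K (Dual K E)} (hL : ∀ φ ∈ L, ∀ ψ, tens ψ φ ∈ S) {j : ℕ} (hj : j ≤ finrank K L) :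
    ∃ S' ≤ S, finrank K S' = finrank K G * j ∧ ∀ B ∈ S', rk B ≤ j := by
  -- The witness consists of the forms `B` with `B.flip` taking values in a `j`-dimensional `L'`.
  obtain ⟨L', hL', rfl⟩ := exists_le_finrank_eq L hj
  let f : (G →ₗ[K] L') →ₗ[K] (G →ₗ[K] Dual K E) := LinearMap.compRight K L'.subtype
  have hf : Function.Injective f := by
    intro a b h
    ext y
    exact DFunLike.congr_fun (DFunLike.congr_fun h y) _
  refine ⟨flipSpace (range f), ?_, ?_, ?_⟩
  · intro B hB
    obtain ⟨C, hC⟩ := mem_flipSpace.1 hB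
    let b := Module.finBasis K G
    have hBsum : B = ∑ i, tens (b.coord i) (C (b i)).1 := by
      have : B.flip = ∑ i, tens (C (b i)).1 (b.coord i) := by
        refine b.ext fun i => ?_
        rw [← hC, LinearMap.sum_apply, Finset.sum_eq_single i]
        · simp [f]
        · intro l _ hl
          simp [Finsupp.single_eq_of_ne hl]
        · simp
      rw [← B.flip_flip, this]
      ext x y
      simp [LinearMap.sum_apply, mul_comm]
    rw [hBsum]
    exact S.sum_mem fun i _ => hL _ (hL' (C (b i)).2) _
  · rw [finrank_flipSpace, LinearMap.finrank_range_of_inj hf]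
    have : Module.Free K L' := Module.Free.of_divisionRing K L'
    exact Module.finrank_linearMap K K G L'
  · intro B hB
    obtain ⟨C, hC⟩ := mem_flipSpace.1 hB
    rw [← rk_flip, ← hC, rk]
    have : range (f C) ≤ L' := by
      rintro _ ⟨y, rfl⟩
      exact (C y).2
    exact Submodule.finrank_mono this

/-- A space of bilinear forms of rank at most `k` and of maximal dimension contains a space of
forms of rank at most `k - 1` and of maximal dimension. -/
theorem exists_le_finrank_eq_of_rk_le {S : Submodule K (E →ₗ[K] Dual K G)} {k : ℕ}
    (hS : ∀ B ∈ S, rk B ≤ k) (hEG : finrank K E ≤ finrank K G) (hk0 : 0 < k)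
    (hkE : k ≤ finrank K E) (hdim : finrank K S = finrank K G * k) :
    ∃ S' ≤ S, finrank K S' = finrank K G * (k - 1) ∧ ∀ B ∈ S', rk B ≤ k - 1 := by
  by_cases hslice : ∀ ψ : Dual K G, ψ ≠ 0 → slice S ψ ≠ ⊥
  · obtain ⟨L, hLk, hL⟩ := exists_common_slice hS hEG hk0 hkE hdim hslice
    exact exists_le_of_common_slice hL (by omega)
  push Not at hslice
  obtain ⟨ψ₀, hψ₀, h0⟩ := hslice
  have hEG' : finrank K E = finrank K G := by
    by_contra hne
    exact slice_ne_bot_of_lt hS (by omega) hk0 hdim hψ₀ h0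
  have hflip : ∀ φ : Dual K E, φ ≠ 0 → slice (flipSpace S) φ ≠ ⊥ := by
    intro φ hφ
    rcases hkE.eq_or_lt with hk | hk
    · have : S = ⊤ := by
        refine Submodule.eq_top_of_finrank_eq (V := E →ₗ[K] Dual K G) ?_
        rw [hdim, Module.finrank_linearMap, Subspace.dual_finrank_eq, mul_comm, hk]
      intro h
      refine hψ₀ ((Submodule.mem_bot K).1 (h ▸ ?_))
      rw [mem_slice, tens_mem_flipSpace, this]
      trivial
    · exact slice_flipSpace_ne_bot hS hEG' hk0 hk hdim hψ₀ h0 hφ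
  have hdim' : finrank K (flipSpace S) = finrank K E * k := by
    rw [finrank_flipSpace, hdim, hEG']
  obtain ⟨L, hLk, hL⟩ := exists_common_slice (rk_flip_le hS) hEG'.ge hk0 (hEG' ▸ hkE) hdim' hflip
  obtain ⟨S', hS', hdimS', hrkS'⟩ := exists_le_of_common_slice hL (j := k - 1) (by omega)
  refine ⟨flipSpace S', ?_, ?_, rk_flip_le hrkS'⟩
  · intro B hB
    have := hS' (mem_flipSpace.1 hB)
    rwa [mem_flipSpace, LinearMap.flip_flip] at this
  · rw [finrank_flipSpace, hdimS', hEG']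

end Bilinear

/-! ### Optimal anticodes of matrices. -/

section MaxRank

variable {F : Type*} [Field F] {a b : ℕ}

/-- Matrices with `a` rows and `b` columns as bilinear forms on `F^b × F^a`. -/
noncomputable def matrixBilinear (F : Type*) [Field F] (a b : ℕ) :
    Matrix (Fin a) (Fin b) F ≃ₗ[F] ((Fin b → F) →ₗ[F] Dual F (Fin a → F)) :=
  Matrix.toLin' ≪≫ₗ LinearEquiv.congrRight (dotProductEquiv F (Fin a))

lemma rk_matrixBilinear (X : Matrix (Fin a) (Fin b) F) : rk (matrixBilinear F a b X) = X.rank := by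
  have : matrixBilinear F a b X = (dotProductEquiv F (Fin a)).toLinearMap ∘ₗ X.mulVecLin := rfl
  rw [rk, this, LinearMap.range_comp, LinearEquiv.finrank_map_eq, Matrix.rank]

variable (A : Submodule F (Matrix (Fin a) (Fin b) F))

lemma bddAbove_rank : BddAbove {d : ℕ | ∃ X ∈ A, X.rank = d} :=
  ⟨b, by rintro _ ⟨X, -, rfl⟩; simpa using X.rank_le_width⟩

variable {A}

lemma rank_le_maxrk {X : Matrix (Fin a) (Fin b) F} (hX : X ∈ A) : X.rank ≤ maxrk A :=
  le_csSup (bddAbove_rank A) ⟨X, hX, rfl⟩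

variable (A)

lemma exists_rank_eq_maxrk : ∃ X ∈ A, X.rank = maxrk A :=
  Nat.sSup_mem (s := {d : ℕ | ∃ X ∈ A, X.rank = d}) ⟨_, 0, A.zero_mem, rfl⟩ (bddAbove_rank A)

lemma maxrk_le : maxrk A ≤ b := by
  obtain ⟨X, -, hX⟩ := exists_rank_eq_maxrk A
  rw [← hX]
  simpa using X.rank_le_width

/-- The anticode bound. -/
lemma finrank_le_mul_maxrk (hba : b ≤ a) : finrank F A ≤ a * maxrk A := by
  have h := finrank_le_of_rk_le (S := A.map (matrixBilinear F a b).toLinearMap) (k := maxrk A) (by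
    rintro _ ⟨X, hX, rfl⟩
    exact (rk_matrixBilinear X).trans_le (rank_le_maxrk hX))
  rw [finrank_fin_fun, finrank_fin_fun, max_eq_right hba] at h
  exact (LinearEquiv.finrank_map_eq (matrixBilinear F a b) A).symm.trans_le h

variable {A}

/-- An optimal anticode of positive maximum rank contains an optimal anticode whose maximum rank is
smaller by one. -/
lemma IsOptimalAnticode.exists_le_maxrk_add_one (hba : b ≤ a) (hb : 0 < b)
    (hA : IsOptimalAnticode A) (hpos : 0 < maxrk A) :
    ∃ A' ≤ A, IsOptimalAnticode A' ∧ maxrk A' + 1 = maxrk A := by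
  let e := matrixBilinear F a b
  obtain ⟨S', hS', hdim, hrk⟩ := exists_le_finrank_eq_of_rk_le (S := A.map e.toLinearMap)
    (k := maxrk A) (by
      rintro _ ⟨X, hX, rfl⟩
      exact (rk_matrixBilinear X).trans_le (rank_le_maxrk hX))
    (by simpa using hba) hpos (by simpa using maxrk_le A) (by
      rw [finrank_fin_fun]
      exact (LinearEquiv.finrank_map_eq e A).trans hA)
  rw [finrank_fin_fun] at hdim
  have hle : S'.comap e.toLinearMap ≤ A := by
    intro X hX
    obtain ⟨Y, hY, hXY⟩ := hS' hX
    rwa [← e.injective hXY]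
  have hdim' : finrank F (S'.comap e.toLinearMap) = a * (maxrk A - 1) := by
    rw [← hdim, ← LinearEquiv.finrank_map_eq e]
    exact congrArg (fun T : Submodule F ((Fin b → F) →ₗ[F] Dual F (Fin a → F)) => finrank F T)
      (Submodule.map_comap_eq_of_surjective e.surjective S')
  have hmax : maxrk (S'.comap e.toLinearMap) ≤ maxrk A - 1 := by
    obtain ⟨X, hX, hX'⟩ := exists_rank_eq_maxrk (S'.comap e.toLinearMap)
    rw [← hX', ← rk_matrixBilinear]
    exact hrk _ hX
  have hmax' : maxrk (S'.comap e.toLinearMap) = maxrk A - 1 := by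
    -- The anticode bound forces the maximum rank up to `maxrk A - 1`, since the factor `a` is
    -- positive and cancels.
    refine le_antisymm hmax (Nat.le_of_mul_le_mul_left ?_ (hb.trans_le hba))
    rw [← hdim']
    exact finrank_le_mul_maxrk _ hba
  refine ⟨_, hle, ?_, ?_⟩
  · rw [IsOptimalAnticode, hdim', hmax']
  · omega

lemma isOptimalAnticode_top (hba : b ≤ a) :
    IsOptimalAnticode (⊤ : Submodule F (Matrix (Fin a) (Fin b) F)) := by
  refine le_antisymm (finrank_le_mul_maxrk _ hba) ?_
  rw [finrank_top, Module.finrank_matrix]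
  simpa using Nat.mul_le_mul_left a (maxrk_le (⊤ : Submodule F (Matrix (Fin a) (Fin b) F)))

end MaxRank

/-! ### Weights of codes and lowering them by one block. -/

section Weight

variable {F : Type*} [Field F] {t : ℕ} {m n : Fin t → ℕ}

lemma srk_le (X : Ambient F m n) : srk X ≤ ∑ i, n i :=
  Finset.sum_le_sum fun i _ => by simpa using (X i).rank_le_width

lemma srk_le_maxsrk {C : Submodule F (Ambient F m n)} {X : Ambient F m n} (hX : X ∈ C) :
    srk X ≤ maxsrk C :=
  le_csSup ⟨_, by rintro _ ⟨X, -, rfl⟩; exact srk_le X⟩ ⟨X, hX, rfl⟩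

lemma exists_srk_eq_maxsrk (C : Submodule F (Ambient F m n)) : ∃ X ∈ C, srk X = maxsrk C :=
  Nat.sSup_mem (s := {d : ℕ | ∃ X ∈ C, srk X = d}) ⟨_, 0, C.zero_mem, rfl⟩
    ⟨_, by rintro _ ⟨X, -, rfl⟩; exact srk_le X⟩

lemma maxsrk_pi (A : (i : Fin t) → Submodule F (Matrix (Fin (m i)) (Fin (n i)) F)) :
    maxsrk (Submodule.pi Set.univ A) = ∑ i, maxrk (A i) := by
  apply le_antisymm
  · obtain ⟨X, hX, h⟩ := exists_srk_eq_maxsrk (Submodule.pi Set.univ A)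
    rw [← h]
    exact Finset.sum_le_sum fun i _ => rank_le_maxrk (hX i trivial)
  · choose X hX h using fun i => exists_rank_eq_maxrk (A i)
    calc ∑ i, maxrk (A i) = srk (m := m) (n := n) X := by simp only [srk, h]
      _ ≤ _ := srk_le_maxsrk (Submodule.mem_pi.2 fun i _ => hX i)

lemma wt_le {C : Submodule F (Ambient F m n)}
    {A : (i : Fin t) → Submodule F (Matrix (Fin (m i)) (Fin (n i)) F)}
    (hA : ∀ i, IsOptimalAnticode (A i)) (hCA : C ≤ Submodule.pi Set.univ A) :
    wt C ≤ ∑ i, maxrk (A i) :=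
  Nat.sInf_le ⟨A, hA, hCA, maxsrk_pi A⟩

lemma exists_wt_eq (hmn : ∀ i, n i ≤ m i) (C : Submodule F (Ambient F m n)) :
    ∃ A : (i : Fin t) → Submodule F (Matrix (Fin (m i)) (Fin (n i)) F),
      (∀ i, IsOptimalAnticode (A i)) ∧ C ≤ Submodule.pi Set.univ A ∧ wt C = ∑ i, maxrk (A i) := by
  obtain ⟨A, hA, hCA, h⟩ := Nat.sInf_mem (s := {w : ℕ |
    ∃ A : (i : Fin t) → Submodule F (Matrix (Fin (m i)) (Fin (n i)) F),
    (∀ i, IsOptimalAnticode (A i)) ∧ C ≤ Submodule.pi Set.univ A ∧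
      maxsrk (Submodule.pi Set.univ A) = w})
    ⟨_, fun _ => ⊤, fun i => isOptimalAnticode_top (hmn i), fun X _ i _ => trivial, rfl⟩
  exact ⟨A, hA, hCA, by rw [← maxsrk_pi, h]; rfl⟩

lemma wt_le_sum (hmn : ∀ i, n i ≤ m i) (C : Submodule F (Ambient F m n)) : wt C ≤ ∑ i, n i :=
  (wt_le (A := fun _ => ⊤) (fun i => isOptimalAnticode_top (hmn i)) fun _ _ _ _ => trivial).trans
    (Finset.sum_le_sum fun _ _ => maxrk_le _)

lemma srk_le_wt (hmn : ∀ i, n i ≤ m i) {C : Submodule F (Ambient F m n)} {X : Ambient F m n}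
    (hX : X ∈ C) : srk X ≤ wt C := by
  obtain ⟨A, -, hCA, h⟩ := exists_wt_eq hmn C
  rw [h, ← maxsrk_pi]
  exact srk_le_maxsrk (hCA hX)

/-- The number of rows of the highest block among those that can be the last nonzero block of an
element of sum-rank weight `w`. -/
def blockHeight (m n : Fin t → ℕ) (w : ℕ) : ℕ :=
  (Finset.univ.filter fun i => w ≤ ∑ l ∈ Finset.Iic i, n l).sup m

/-- A code of positive weight `w` has a subcode of smaller weight whose codimension is at most
`blockHeight m n w`. -/
lemma exists_le_wt_lt (hn : ∀ i, 0 < n i) (hmn : ∀ i, n i ≤ m i) {C : Submodule F (Ambient F m n)}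
    (hC : 0 < wt C) :
    ∃ C' ≤ C, wt C' < wt C ∧ finrank F C ≤ finrank F C' + blockHeight m n (wt C) := by
  obtain ⟨A, hA, hCA, hw⟩ := exists_wt_eq hmn C
  have hne : (Finset.univ.filter fun i => 0 < maxrk (A i)).Nonempty := by
    by_contra h
    rw [Finset.not_nonempty_iff_eq_empty, Finset.filter_eq_empty_iff] at h
    rw [hw, Finset.sum_eq_zero fun i hi => by simpa using h hi] at hC
    exact lt_irrefl _ hC
  -- All factors after the last nonzero block `i` contribute nothing, so the weight is at most the
  -- sum of `n l` over `l ≤ i`; this is what bounds `m i` by `blockHeight`.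
  set i := Finset.max' _ hne
  have hipos : 0 < maxrk (A i) := (Finset.mem_filter.1 (Finset.max'_mem _ hne)).2
  obtain ⟨A', hA'A, hA', hrk⟩ := (hA i).exists_le_maxrk_add_one (hmn i) (hn i) hipos
  have hheight : m i ≤ blockHeight m n (wt C) := by
    refine Finset.le_sup (f := m) (Finset.mem_filter.2 ⟨Finset.mem_univ _, ?_⟩)
    rw [hw, ← Finset.sum_subset (Finset.subset_univ (Finset.Iic i))]
    · exact Finset.sum_le_sum fun l _ => maxrk_le _
    · intro l _ hl
      by_contra h
      exact hl (Finset.mem_Iic.2 (Finset.le_max' _ l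
        (Finset.mem_filter.2 ⟨Finset.mem_univ _, Nat.pos_of_ne_zero h⟩)))
  refine ⟨C ⊓ A'.comap (LinearMap.proj i), inf_le_left, ?_, ?_⟩
  · have h1 : wt (C ⊓ A'.comap (LinearMap.proj i)) ≤ ∑ l, maxrk (Function.update A i A' l) := by
      refine wt_le (fun l => ?_) fun X hX => Submodule.mem_pi.2 fun l _ => ?_
      · rcases eq_or_ne l i with rfl | hl
        · rwa [Function.update_self]
        · rw [Function.update_of_ne hl]
          exact hA l
      · rcases eq_or_ne l i with rfl | hl
        · rw [Function.update_self]
          exact hX.2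
        · rw [Function.update_of_ne hl]
          exact hCA hX.1 l trivial
    refine h1.trans_lt ?_
    rw [hw]
    refine Finset.sum_lt_sum (fun l _ => ?_) ⟨i, Finset.mem_univ _, ?_⟩
    · rcases eq_or_ne l i with rfl | hl
      · rw [Function.update_self]
        omega
      · rw [Function.update_of_ne hl]
    · rw [Function.update_self]
      omega
  · have h := finrank_le_finrank_inf_comap (C := C) (A := A i) (A' := A') (LinearMap.proj i) (by
      rintro _ ⟨X, hX, rfl⟩
      exact hCA hX i trivial) hA'A
    rw [hA i, hA', ← hrk, mul_add, mul_one] at h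
    omega

end Weight

/-! ### Multiplicities in the sequence of generalized weights. -/

section GeneralizedWeights

variable {F : Type*} [Field F] {t : ℕ} {m n : Fin t → ℕ} {C D : Submodule F (Ambient F m n)}

lemma genWeight_le {C' : Submodule F (Ambient F m n)} (h : C' ≤ C) {r : ℕ}
    (hr : r ≤ finrank F C') : genWeight C r ≤ wt C' :=
  Nat.sInf_le ⟨C', h, hr, rfl⟩

lemma exists_genWeight_eq {r : ℕ} (hr : r ≤ finrank F C) :
    ∃ C' ≤ C, r ≤ finrank F C' ∧ wt C' = genWeight C r :=
  Nat.sInf_mem (s := {w : ℕ | ∃ C' : Submodule F (Ambient F m n),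
    C' ≤ C ∧ r ≤ finrank F C' ∧ wt C' = w}) ⟨_, C, le_rfl, hr, rfl⟩

lemma genWeight_mono {r s : ℕ} (hrs : r ≤ s) (hs : s ≤ finrank F C) :
    genWeight C r ≤ genWeight C s := by
  obtain ⟨C', hC', hs', h⟩ := exists_genWeight_eq hs
  rw [← h]
  exact genWeight_le hC' (hrs.trans hs')

lemma monotone_genWeightSeq (C : Submodule F (Ambient F m n)) : Monotone (genWeightSeq C) :=
  fun _ s hrs => genWeight_mono (Nat.succ_le_succ hrs) s.2

lemma minDist_le_genWeight (hmn : ∀ i, n i ≤ m i) (hCD : C ≤ D) {r : ℕ} (hr0 : 0 < r)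
    (hr : r ≤ finrank F C) : minDist D ≤ genWeight C r := by
  obtain ⟨C', hC', hr', h⟩ := exists_genWeight_eq hr
  have hne : C' ≠ ⊥ := by
    rintro rfl
    rw [finrank_bot] at hr'
    omega
  obtain ⟨X, hX, hX0⟩ := Submodule.exists_mem_ne_zero_of_ne_bot hne
  have hd : minDist D ≤ srk X := Nat.sInf_le ⟨X, hCD (hC' hX), hX0, rfl⟩
  exact h ▸ hd.trans (srk_le_wt hmn hX)

lemma genWeight_le_sum (hmn : ∀ i, n i ≤ m i) {r : ℕ} (hr : r ≤ finrank F C) :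
    genWeight C r ≤ ∑ i, n i := by
  obtain ⟨C', -, -, h⟩ := exists_genWeight_eq hr
  rw [← h]
  exact wt_le_sum hmn C'

/-- If `s` were larger, a subcode realizing the `s`-th weight could be shrunk to smaller weight
while keeping dimension at least `r`, contradicting the minimality of the `r`-th weight. -/
lemma lt_add_blockHeight (hn : ∀ i, 0 < n i) (hmn : ∀ i, n i ≤ m i) {r s : ℕ}
    (hs : s ≤ finrank F C) (hpos : 0 < genWeight C r) (heq : genWeight C s = genWeight C r) :
    s < r + blockHeight m n (genWeight C r) := by
  obtain ⟨C', hC', hs', h⟩ := exists_genWeight_eq hs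
  rw [heq] at h
  obtain ⟨C'', hC'', hlt, hdim⟩ := exists_le_wt_lt hn hmn (C := C') (h ▸ hpos)
  by_contra! hle
  have := genWeight_le (hC''.trans hC') (r := r) (by rw [h] at hdim; omega)
  omega

/-- Each value occurs at most `blockHeight` times in the sequence of generalized weights. -/
lemma card_genWeightSeq_eq_le (hn : ∀ i, 0 < n i) (hmn : ∀ i, n i ≤ m i)
    (C : Submodule F (Ambient F m n)) {w : ℕ} (hw : 0 < w) :
    (Finset.univ.filter fun r => genWeightSeq C r = w).card ≤ blockHeight m n w := by
  rcases (Finset.univ.filter fun r => genWeightSeq C r = w).eq_empty_or_nonempty with h | h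
  · simp [h]
  set r := Finset.min' _ h
  have hrw : genWeight C (r + 1) = w := (Finset.mem_filter.1 (Finset.min'_mem _ h)).2
  rw [← Finset.card_map Fin.valEmbedding]
  calc _ ≤ (Finset.Ico (r : ℕ) (r + blockHeight m n w)).card := by
        apply Finset.card_le_card
        intro x hx
        obtain ⟨s, hs, rfl⟩ := Finset.mem_map.1 hx
        have h1 : r ≤ s := Finset.min'_le _ s hs
        have h2 := lt_add_blockHeight hn hmn (r := r + 1) (s := s + 1) (C := C) s.2
          (hrw ▸ hw) (((Finset.mem_filter.1 hs).2).trans hrw.symm)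
        rw [hrw] at h2
        rw [Finset.mem_Ico]
        rw [Fin.valEmbedding_apply]
        exact ⟨h1, by omega⟩
    _ = _ := by simp

lemma exists_sum_Iio_lt_le_sum_Iic {w : ℕ} (hw : 0 < w) (hwn : w ≤ ∑ i, n i) :
    ∃ i, ∑ l ∈ Finset.Iio i, n l < w ∧ w ≤ ∑ l ∈ Finset.Iic i, n l := by
  have hne : (Finset.univ.filter fun i => w ≤ ∑ l ∈ Finset.Iic i, n l).Nonempty := by
    obtain _ | t := t
    · simp at hwn
      omega
    · refine ⟨Fin.last t, Finset.mem_filter.2 ⟨Finset.mem_univ _, ?_⟩⟩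
      convert hwn
      ext x
      simp [Fin.le_last]
  set i := Finset.min' _ hne
  refine ⟨i, ?_, (Finset.mem_filter.1 (Finset.min'_mem _ hne)).2⟩
  by_contra! h
  have hIio : (Finset.Iio i).Nonempty := by
    by_contra h0
    rw [Finset.not_nonempty_iff_eq_empty] at h0
    rw [h0, Finset.sum_empty] at h
    omega
  set l := (Finset.Iio i).max' hIio
  have hli : l < i := Finset.mem_Iio.1 (Finset.max'_mem _ hIio)
  have : i ≤ l := by
    refine Finset.min'_le _ l (Finset.mem_filter.2 ⟨Finset.mem_univ _, h.trans ?_⟩)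
    exact Finset.sum_le_sum_of_subset fun x hx => Finset.mem_Iic.2 (Finset.le_max' _ x hx)
  exact absurd hli this.not_gt

lemma blockHeight_le (hm : Antitone m) {i : Fin t} {w : ℕ} (hw : ∑ l ∈ Finset.Iio i, n l < w) :
    blockHeight m n w ≤ m i := by
  refine Finset.sup_le fun l hl => hm ?_
  by_contra! h
  have h1 := (Finset.mem_filter.1 hl).2
  have h2 : ∑ x ∈ Finset.Iic l, n x ≤ ∑ x ∈ Finset.Iio i, n x :=
    Finset.sum_le_sum_of_subset fun x hx => Finset.mem_Iio.2 ((Finset.mem_Iic.1 hx).trans_lt h)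
  omega

lemma sum_Iic_eq (n : Fin t → ℕ) (i : Fin t) :
    ∑ l ∈ Finset.Iic i, n l = ∑ l ∈ Finset.Iio i, n l + n i := by
  rw [← Finset.Iio_insert, Finset.sum_insert (by simp), add_comm]

/-- The interval is cut at the partial sums of `n`. Values in the piece of block `i` have height at
most `m i`; that piece has `n i` values, except that block `j` keeps only `n j - δ`. -/
lemma sum_blockHeight_add_le (hm : Antitone m) {j : Fin t} {δ : ℕ} (hδ : δ < n j) :
    ∑ w ∈ Finset.Icc (∑ i ∈ Finset.Iio j, n i + δ + 1) (∑ i, n i), blockHeight m n w + δ * m j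
      ≤ ∑ i ∈ Finset.Ici j, m i * n i := by
  let s : Fin t → Finset ℕ := fun i =>
    Finset.Ioc (∑ l ∈ Finset.Iio i, n l + if i = j then δ else 0) (∑ l ∈ Finset.Iic i, n l)
  have hsub : Finset.Icc (∑ i ∈ Finset.Iio j, n i + δ + 1) (∑ i, n i) ⊆
      (Finset.Ici j).biUnion s := by
    intro w hw
    rw [Finset.mem_Icc] at hw
    obtain ⟨i, hi, hi'⟩ := exists_sum_Iio_lt_le_sum_Iic (by omega) hw.2
    have hji : j ≤ i := by
      by_contra! h
      have : ∑ x ∈ Finset.Iic i, n x ≤ ∑ x ∈ Finset.Iio j, n x :=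
        Finset.sum_le_sum_of_subset fun x hx =>
          Finset.mem_Iio.2 ((Finset.mem_Iic.1 hx).trans_lt h)
      omega
    refine Finset.mem_biUnion.2 ⟨i, Finset.mem_Ici.2 hji, Finset.mem_Ioc.2 ⟨?_, hi'⟩⟩
    split_ifs with h
    · subst h
      omega
    · omega
  have hs : ∀ i, ∑ w ∈ s i, blockHeight m n w + (if i = j then δ * m j else 0) ≤ m i * n i := by
    intro i
    have h1 : ∑ w ∈ s i, blockHeight m n w ≤ (s i).card * m i :=
      Finset.sum_le_card_nsmul _ _ _ fun w hw => blockHeight_le hm (by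
        have := (Finset.mem_Ioc.1 hw).1
        omega)
    have h2 : (s i).card = n i - if i = j then δ else 0 := by
      simp only [s, Nat.card_Ioc, sum_Iic_eq]
      omega
    rw [h2] at h1
    split_ifs at h1 ⊢ with h
    · subst h
      obtain ⟨c, hc⟩ := Nat.exists_eq_add_of_lt hδ
      rw [hc, show δ + c + 1 - δ = c + 1 by omega] at h1
      rw [hc]
      nlinarith
    · rw [Nat.sub_zero, mul_comm] at h1
      simpa using h1
  have hlt : ∀ i i', i < i' → Disjoint (s i) (s i') := by
    intro i i' hii'
    have : ∑ x ∈ Finset.Iic i, n x ≤ ∑ x ∈ Finset.Iio i', n x :=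
      Finset.sum_le_sum_of_subset fun x hx =>
        Finset.mem_Iio.2 ((Finset.mem_Iic.1 hx).trans_lt hii')
    refine Finset.disjoint_left.2 fun w hw hw' => ?_
    have h1 := (Finset.mem_Ioc.1 hw).2
    have h2 := (Finset.mem_Ioc.1 hw').1
    omega
  have hdisj : (Finset.Ici j : Set (Fin t)).PairwiseDisjoint s := by
    intro i _ i' _ hii'
    rcases lt_or_gt_of_ne hii' with h | h
    · exact hlt i i' h
    · exact (hlt i' i h).symm
  calc _ ≤ ∑ i ∈ Finset.Ici j, ∑ w ∈ s i, blockHeight m n w + δ * m j := by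
        refine Nat.add_le_add_right ((Finset.sum_le_sum_of_subset hsub).trans ?_) _
        rw [Finset.sum_biUnion hdisj]
    _ = ∑ i ∈ Finset.Ici j, (∑ w ∈ s i, blockHeight m n w + if i = j then δ * m j else 0) := by
        rw [Finset.sum_add_distrib, Finset.sum_ite_eq' (Finset.Ici j) j]
        simp
    _ ≤ _ := Finset.sum_le_sum fun i _ => hs i

/-- In the sequence of generalized weights of a maximum sum-rank distance code, each value that is
possible for a subcode occurs as often as possible. -/
lemma IsMSRD.card_genWeightSeq_eq (hn : ∀ i, 0 < n i) (hm : Antitone m) (hmn : ∀ i, n i ≤ m i)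
    (hD : IsMSRD D) {w : ℕ} (hw : minDist D ≤ w) (hwn : w ≤ ∑ i, n i) :
    (Finset.univ.filter fun r => genWeightSeq D r = w).card = blockHeight m n w := by
  obtain ⟨j, δ, hδ, hd, hdim⟩ := hD
  have hle : ∀ w ∈ Finset.Icc (minDist D) (∑ i, n i),
      (Finset.univ.filter fun r => genWeightSeq D r = w).card ≤ blockHeight m n w := by
    intro w hw
    rw [Finset.mem_Icc] at hw
    exact card_genWeightSeq_eq_le hn hmn D (by omega)
  have hsum : ∑ w ∈ Finset.Icc (minDist D) (∑ i, n i),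
      (Finset.univ.filter fun r => genWeightSeq D r = w).card = finrank F D := by
    rw [← Finset.card_eq_sum_card_fiberwise, Finset.card_univ, Fintype.card_fin]
    intro r _
    exact Finset.mem_coe.2 (Finset.mem_Icc.2
      ⟨minDist_le_genWeight hmn le_rfl (Nat.succ_pos _) r.2, genWeight_le_sum hmn r.2⟩)
  have hbound := sum_blockHeight_add_le (n := n) hm hδ
  rw [← hd, ← hdim] at hbound
  -- The multiplicities are bounded termwise by the heights, yet their total `finrank F D` is at
  -- least the total of the heights, so equality holds at every value.
  refine (Finset.sum_eq_sum_iff_of_le hle).1 ?_ w (Finset.mem_Icc.2 ⟨hw, hwn⟩)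
  have := Finset.sum_le_sum hle
  omega

/-- A monotone sequence is a subsequence of another one if no value occurs more often in it. -/
lemma isSubsequence_of_card_le {k l : ℕ} {a : Fin k → ℕ} {b : Fin l → ℕ} (ha : Monotone a)
    (hb : Monotone b) (h : ∀ w, (Finset.univ.filter fun r => a r = w).card ≤
      (Finset.univ.filter fun r => b r = w).card) : IsSubsequence a b := by
  have hcount : ∀ {k : ℕ} (a : Fin k → ℕ) (w : ℕ),
      (List.ofFn a).count w = (Finset.univ.filter fun r => a r = w).card := by
    intro k a w
    rw [← Multiset.coe_count, ← Fin.univ_val_map, Multiset.count_map, Finset.card_def,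
      Finset.filter_val]
    simp only [eq_comm]
  have hsub : (List.ofFn a).Sublist (List.ofFn b) := by
    refine List.sublist_of_subperm_of_sortedLE (List.subperm_ext_iff.2 fun w _ => ?_)
      ha.sortedLE_ofFn hb.sortedLE_ofFn
    rw [hcount, hcount]
    exact h w
  obtain ⟨f, hf⟩ := List.sublist_iff_exists_fin_orderEmbedding_get_eq.1 hsub
  refine ⟨fun r => (f (r.cast List.length_ofFn.symm)).cast List.length_ofFn, ?_, fun r => ?_⟩
  · intro r s hrs
    exact f.strictMono (show r.cast List.length_ofFn.symm < s.cast List.length_ofFn.symm from hrs)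
  · have h := hf (r.cast List.length_ofFn.symm)
    rw [List.get_ofFn, List.get_ofFn] at h
    exact h

end GeneralizedWeights

end SumRank

theorem proposition4p5 {F : Type*} [Field F] [Finite F] {t : ℕ} (m n : Fin t → ℕ)
    (hn : ∀ i, 0 < n i) (hm : Antitone m) (hmn : ∀ i, n i ≤ m i)
    (C D : Submodule F (SumRank.Ambient F m n)) (hCD : C ≤ D) (hD : SumRank.IsMSRD D) :
    SumRank.IsSubsequence (SumRank.genWeightSeq C) (SumRank.genWeightSeq D) := by
  refine SumRank.isSubsequence_of_card_le (SumRank.monotone_genWeightSeq C)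
    (SumRank.monotone_genWeightSeq D) fun w => ?_
  rcases (Finset.univ.filter fun r => SumRank.genWeightSeq C r = w).eq_empty_or_nonempty with h | h
  · simp [h]
  obtain ⟨r, hr⟩ := h
  obtain rfl : SumRank.genWeightSeq C r = w := (Finset.mem_filter.1 hr).2
  have hlow : SumRank.minDist D ≤ SumRank.genWeightSeq C r :=
    SumRank.minDist_le_genWeight hmn hCD (Nat.succ_pos r) r.2
  have hupp : SumRank.genWeightSeq C r ≤ ∑ i, n i := SumRank.genWeight_le_sum hmn r.2
  rw [hD.card_genWeightSeq_eq hn hm hmn hlow hupp]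
  -- The formula for the minimum distance makes it positive, which excludes the value `0`, where the
  -- multiplicity bound is not available.
  obtain ⟨j, δ, -, hd, -⟩ := hD
  exact SumRank.card_genWeightSeq_eq_le hn hmn C (lt_of_lt_of_le (by omega) hlow)
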